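/- Let $D\ge 1$ and let $\mathcal H=\mathbb R^{2D}\times\mathbb R$ be the Heisenberg group with product $$(v,u)\cdot(\tilde v,\tilde u)=\bigl(v+\tilde v,\;u+\tilde u+\tfrac12\omega(v,\tilde v)\bigr),\qquad \omega(v,\tilde v)=\sum_{i=1}^D(p_i\tilde q_i-q_i\tilde p_i),$$ where $p_i,q_i$ (respectively $\tilde p_i,\tilde q_i$) are the coordinates of $v$ (respectively $\tilde v$) in the standard basis $e_1,\dots,e_D,f_1,\dots,f_D$ of $\mathbb R^{2D}$. Let $H\subset\mathcal H$ be the discrete Heisenberg group, i.e. the subgroup generated by the elements $(e_i,0)$ and $(f_i,0)$, $1\le i\le D$. Let $d$ be any homogeneous metric on $\mathcal H$, that is, a metric with $d(gf,hf)=d(g,h)$ for all $f,g,h\in\mathcal H$ and $d(\delta_r g,\delta_r h)=r\,d(g,h)$ for all $r>0$ and $g,h\in\mathcal H$, where $\delta_r(v,u)=(rv,r^2u)$. For $A\subset\mathcal H$ and $t\ge 0$ put $A^t=\{g\in\mathcal H: d(g,A)\le t\}$. Let $H$ act by homeomorphisms on a compact metric space $(\mathbb X,\rho)$. For $A\subset\mathcal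 H$ and $x,y\in\mathbb X$ put $\rho^A(x,y)=\sup\{\rho(gx,gy): g\in A\cap H\}$ (with $\sup\emptyset=0$). A set $A\subset\mathcal H$ is called expansive if there are $\varepsilon>0$ and $t>0$ such that for all $x,y\in\mathbb X$, $\rho^{A^t}(x,y)\le\varepsilon$ implies $x=y$; otherwise $A$ is called nonexpansive. A vertical group of dimension $k$ is a normal subgroup of $\mathcal H$ of the form $V\times\mathbb R$, where $V\subset\mathbb R^{2D}$ is a linear subspace of dimension $k-1$. Theorem 5.11. If $\mathcal G=V\times\mathbb R$ is a nonexpansive vertical group of dimension $k\le 2D-1$, then there is a nonexpansive vertical group of dimension $2D$ that contains $\mathcal G$. -/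

import Mathlib

/-- The underlying set `ℝ^{2D} × ℝ` of the `(2D+1)`-dimensional Heisenberg group. For a point
`(v, u)`, the coordinates of `v` with respect to the standard basis `e_1, …, e_D, f_1, …, f_D` are
`p_i = v (Sum.inl i)` and `q_i = v (Sum.inr i)`. -/
@[ext]
structure Heisenberg (D : ℕ) where
  /-- the horizontal part `v = π (v, u)` -/
  v : EuclideanSpace ℝ (Fin D ⊕ Fin D)
  /-- the vertical coordinate `u` -/
  u : ℝ

namespace Heisenberg

variable {D : ℕ}

/-- The standard symplectic form `ω(v, w) = ∑ i, (p_i(v) q_i(w) - q_i(v) p_i(w))` on `ℝ^{2D}`. -/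
def omega (v w : EuclideanSpace ℝ (Fin D ⊕ Fin D)) : ℝ :=
  ∑ i : Fin D, (v (Sum.inl i) * w (Sum.inr i) - v (Sum.inr i) * w (Sum.inl i))

theorem omega_add_left (v w x : EuclideanSpace ℝ (Fin D ⊕ Fin D)) :
    omega (v + w) x = omega v x + omega w x := by
  simp only [omega, ← Finset.sum_add_distrib, PiLp.add_apply]
  exact Finset.sum_congr rfl fun i _ => by ring

theorem omega_add_right (v w x : EuclideanSpace ℝ (Fin D ⊕ Fin D)) :
    omega v (w + x) = omega v w + omega v x := by
  simp only [omega, ← Finset.sum_add_distrib, PiLp.add_apply]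
  exact Finset.sum_congr rfl fun i _ => by ring

theorem omega_neg_left (v w : EuclideanSpace ℝ (Fin D ⊕ Fin D)) :
    omega (-v) w = -omega v w := by
  simp only [omega, ← Finset.sum_neg_distrib, PiLp.neg_apply]
  exact Finset.sum_congr rfl fun i _ => by ring

theorem omega_self (v : EuclideanSpace ℝ (Fin D ⊕ Fin D)) : omega v v = 0 :=
  Finset.sum_eq_zero fun i _ => by ring

theorem omega_zero_left (v : EuclideanSpace ℝ (Fin D ⊕ Fin D)) : omega 0 v = 0 := by
  simp [omega]

theorem omega_zero_right (v : EuclideanSpace ℝ (Fin D ⊕ Fin D)) : omega v 0 = 0 := by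
  simp [omega]

/-- `(v, u) (w, s) = (v + w, u + s + ω(v, w) / 2)`. -/
noncomputable instance : Mul (Heisenberg D) :=
  ⟨fun g h => ⟨g.v + h.v, g.u + h.u + (1 / 2) * omega g.v h.v⟩⟩

instance : One (Heisenberg D) := ⟨⟨0, 0⟩⟩

noncomputable instance : Inv (Heisenberg D) := ⟨fun g => ⟨-g.v, -g.u⟩⟩

@[simp] theorem mul_v (g h : Heisenberg D) : (g * h).v = g.v + h.v := rfl

@[simp] theorem mul_u (g h : Heisenberg D) :
    (g * h).u = g.u + h.u + (1 / 2) * omega g.v h.v := rfl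

@[simp] theorem one_v : (1 : Heisenberg D).v = 0 := rfl

@[simp] theorem one_u : (1 : Heisenberg D).u = 0 := rfl

@[simp] theorem inv_v (g : Heisenberg D) : (g⁻¹).v = -g.v := rfl

@[simp] theorem inv_u (g : Heisenberg D) : (g⁻¹).u = -g.u := rfl

/-- The Heisenberg group. -/
noncomputable instance : Group (Heisenberg D) :=
  Group.ofLeftAxioms
    (fun a b c => by
      ext1
      · simp [add_assoc]
      · simp only [mul_v, mul_u, omega_add_left, omega_add_right]; ring)
    (fun a => by
      ext1
      · simp
      · simp [omega_zero_left])
    (fun a => by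
      ext1
      · simp
      · simp [omega_neg_left, omega_self])

/-- The element `x_i = (e_i, 0)`. -/
noncomputable def x (i : Fin D) : Heisenberg D := ⟨EuclideanSpace.single (Sum.inl i) 1, 0⟩

/-- The element `y_i = (f_i, 0)`. -/
noncomputable def y (i : Fin D) : Heisenberg D := ⟨EuclideanSpace.single (Sum.inr i) 1, 0⟩

/-- The discrete Heisenberg group: the subgroup generated by all `x_i` and `y_i`. -/
noncomputable def discrete (D : ℕ) : Subgroup (Heisenberg D) :=
  Subgroup.closure (Set.range x ∪ Set.range y)

/-- The dilation `δ_r (v, u) = (r v, r² u)`. -/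
noncomputable def dilation (r : ℝ) (g : Heisenberg D) : Heisenberg D := ⟨r • g.v, r ^ 2 * g.u⟩

/-- The given metric on the Heisenberg group is homogeneous: it is invariant under right
translations and scales by `r` under the dilation `δ_r`, `r > 0`. -/
structure IsHomogeneousMetric (D : ℕ) [MetricSpace (Heisenberg D)] : Prop where
  dist_mul_right : ∀ f g h : Heisenberg D, dist (g * f) (h * f) = dist g h
  dist_dilation : ∀ r : ℝ, 0 < r → ∀ g h : Heisenberg D,
    dist (dilation r g) (dilation r h) = r * dist g h

/-- `G` is a vertical group of dimension `k`: a normal subgroup of the form `V × ℝ`, where `V` is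
a linear subspace of `ℝ^{2D}` of dimension `k - 1`. -/
def IsVerticalGroup (G : Subgroup (Heisenberg D)) (k : ℕ) : Prop :=
  G.Normal ∧ ∃ V : Submodule ℝ (EuclideanSpace ℝ (Fin D ⊕ Fin D)),
    (G : Set (Heisenberg D)) = {g | g.v ∈ V} ∧ Module.finrank ℝ V + 1 = k

section Action

variable (X : Type*) [MetricSpace X] [MulAction (discrete D) X]

/-- `ρ^A(x, y) = sup {ρ(g x, g y) : g ∈ A ∩ H}`, where `H` is the discrete Heisenberg group. -/
noncomputable def distAlong (A : Set (Heisenberg D)) (x y : X) : ℝ :=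
  sSup {r : ℝ | ∃ g : discrete D, (g : Heisenberg D) ∈ A ∧ r = dist (g • x) (g • y)}

/-- A set `A` in the Heisenberg group is expansive (for the action of the discrete Heisenberg group
on `X`) if there are `ε > 0` and `t > 0` such that `ρ^{A^t}(x, y) ≤ ε` implies `x = y`. Here `A^t`
is the closed thickening `{g | d(g, A) ≤ t}`. -/
def IsExpansive [MetricSpace (Heisenberg D)] (A : Set (Heisenberg D)) : Prop :=
  ∃ ε > 0, ∃ t > 0, ∀ x y : X, distAlong X (Metric.cthickening t A) x y ≤ ε → x = y

end Action

end Heisenberg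

/-! A homogeneous metric sees `V × ℝ` only through horizontal parts: its thickenings lie between
strips around `V`, because horizontal vectors have lifts of comparable norm (`exists_lift_dist_le`)
and commutators give the reverse bound (`exists_norm_le_dist`). What remains concerns a homomorphism
`p` to a Euclidean space, where the Boyle–Lind argument applies. Suppose the whole action is
expansive with constant `e`. A distinct pair that stays close near `V` separates somewhere.
Translating by a separating element almost nearest to `V` puts the separation at the identity and
the closeness on a wide cylinder whose boundary passes near the origin. As the width grows, the
cylinders exhaust a half space with normal `w ⊥ V`, and compactness gives a limit pair
(`exists_close_on_halfSpace`). Deep inside that half space, uniform expansiveness improves `e` to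
any `ε` on slabs around `wᗮ`. If the action is not expansive, every hyperplane containing `V` works.
-/

open Filter Topology

/-! ### The Boyle–Lind argument over a Euclidean space. -/

section Dynamics

variable {X : Type*} [MetricSpace X] {Γ : Type*} [Group Γ] [MulAction Γ X]

/-- Uniform expansiveness: closeness along a large enough part of the group forces closeness. -/
theorem exists_radius_of_expansive [CompactSpace X] [ContinuousConstSMul Γ X] {E : Type*}
    [NormedAddCommGroup E] (p : Γ → E) {e : ℝ}
    (hexp : ∀ x y : X, (∀ h : Γ, dist (h • x) (h • y) ≤ e) → x = y) {ε : ℝ} (hε : 0 < ε) :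
    ∃ T : ℝ, ∀ x y : X, (∀ h : Γ, ‖p h‖ ≤ T → dist (h • x) (h • y) ≤ e) → dist x y ≤ ε := by
  by_contra! hcon
  choose x y hxy hε' using fun n : ℕ => hcon n
  obtain ⟨⟨a, b⟩, -, φ, hφ, hlim⟩ :=
    (isCompact_univ (X := X × X)).tendsto_subseq (x := fun n => (x n, y n)) fun _ => Set.mem_univ _
  have ha : Tendsto (fun n => x (φ n)) atTop (𝓝 a) := (continuous_fst.tendsto _).comp hlim
  have hb : Tendsto (fun n => y (φ n)) atTop (𝓝 b) := (continuous_snd.tendsto _).comp hlim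
  have hab : ε ≤ dist a b := ge_of_tendsto' (ha.dist hb) fun n => (hε' _).le
  have heq : a = b := by
    refine hexp a b fun h => ?_
    refine le_of_tendsto ((ha.const_smul h).dist (hb.const_smul h)) ?_
    have hn : Tendsto (fun n => ((φ n : ℕ) : ℝ)) atTop atTop :=
      tendsto_natCast_atTop_atTop.comp hφ.tendsto_atTop
    filter_upwards [hn.eventually_ge_atTop ‖p h‖] with n hn
    exact hxy _ h hn
  rw [heq, dist_self] at hab
  exact absurd hab (not_le.2 hε)

/-- Given distinct points whose orbits stay close near `ker P`, translate them so that they are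
apart, but stay close over a ball in `P`-coordinates whose boundary nearly contains the origin. -/
theorem exists_translate_near_boundary {E : Type*} [NormedAddCommGroup E] [InnerProductSpace ℝ E]
    (p : Γ → E) (hp : ∀ g h, p (g * h) = p g + p h)
    (P : E →L[ℝ] E) {e : ℝ} (hexp : ∀ x y : X, (∀ h : Γ, dist (h • x) (h • y) ≤ e) → x = y)
    (t : ℝ) (hne : ∃ x y : X, x ≠ y ∧ ∀ h : Γ, ‖P (p h)‖ ≤ t → dist (h • x) (h • y) ≤ e) :
    ∃ (a b : X) (g : Γ), t < ‖P (p g)‖ ∧ e < dist a b ∧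
      ∀ h : Γ, ‖P (p h) + P (p g)‖ < ‖P (p g)‖ - 1 → dist (h • a) (h • b) ≤ e := by
  obtain ⟨x, y, hxy, hclose⟩ := hne
  set R : Set ℝ := {r | ∃ h : Γ, e < dist (h • x) (h • y) ∧ r = ‖P (p h)‖} with hR
  have hRne : R.Nonempty := by
    by_contra hemp
    refine hxy (hexp x y fun h => le_of_not_gt fun hh => hemp ⟨_, h, hh, rfl⟩)
  have hbdd : BddBelow R := ⟨0, by rintro _ ⟨h, -, rfl⟩; exact norm_nonneg _⟩
  -- The infimum need not be attained; the slack of 1 becomes the `- 1` in the radius.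
  obtain ⟨_, ⟨g, hg, rfl⟩, hlt⟩ := exists_lt_of_csInf_lt hRne (lt_add_one (sInf R))
  refine ⟨g • x, g • y, g, lt_of_not_ge fun hle => absurd (hclose g hle) (not_le.2 hg), hg, ?_⟩
  intro h hh
  by_contra hfar
  rw [not_le, smul_smul, smul_smul] at hfar
  have := csInf_le hbdd (show ‖P (p (h * g))‖ ∈ R from ⟨_, hfar, rfl⟩)
  rw [hp, map_add] at this
  linarith

variable [CompactSpace X] [ContinuousConstSMul Γ X]
  {E : Type*} [NormedAddCommGroup E] [InnerProductSpace ℝ E] [FiniteDimensional ℝ E]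

/-- If the action is expansive but not expansive along `V`, then there are distinct points whose
orbits stay close over a half space whose boundary is parallel to `V`. -/
theorem exists_close_on_halfSpace (p : Γ → E)
    (hp : ∀ g h, p (g * h) = p g + p h) (V : Submodule ℝ E) {e : ℝ} (he : 0 < e)
    (hexp : ∀ x y : X, (∀ h : Γ, dist (h • x) (h • y) ≤ e) → x = y)
    (hne : ∀ t > 0, ∃ x y : X, x ≠ y ∧
      ∀ h : Γ, ‖Vᗮ.starProjection (p h)‖ ≤ t → dist (h • x) (h • y) ≤ e) :
    ∃ w ∈ Vᗮ, ‖w‖ = 1 ∧ ∃ a b : X, a ≠ b ∧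
      ∀ h : Γ, inner ℝ (p h) w < -2 → dist (h • a) (h • b) ≤ e := by
  set P := Vᗮ.starProjection with hP
  choose a b g hg hab hclose using fun n : ℕ =>
    exists_translate_near_boundary p hp P hexp (n + 1) (hne (n + 1) (by positivity))
  set u : ℕ → E := fun n => P (p (g n)) with hu
  have hupos : ∀ n, 0 < ‖u n‖ := fun n => lt_trans (by positivity) (hg n)
  set s : ℕ → E := fun n => ‖u n‖⁻¹ • u n with hs
  have hsmem : ∀ n, s n ∈ Metric.sphere (0 : E) 1 ∩ (Vᗮ : Set E) := fun n => by
    refine ⟨?_, Vᗮ.smul_mem _ (Submodule.starProjection_apply_mem _ _)⟩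
    rw [mem_sphere_zero_iff_norm, hs, norm_smul, norm_inv, norm_norm,
      inv_mul_cancel₀ (hupos n).ne']
  have hcpt : IsCompact (Metric.sphere (0 : E) 1 ∩ (Vᗮ : Set E)) :=
    (isCompact_sphere 0 1).inter_right (Submodule.closed_of_finiteDimensional _)
  obtain ⟨⟨⟨a', b'⟩, w⟩, ⟨-, hw⟩, φ, hφ, hlim⟩ :=
    ((isCompact_univ (X := X × X)).prod hcpt).tendsto_subseq
      (x := fun n => ((a n, b n), s n)) fun n => ⟨Set.mem_univ _, hsmem n⟩
  have ha : Tendsto (fun n => a (φ n)) atTop (𝓝 a') :=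
    ((continuous_fst.comp continuous_fst).tendsto _).comp hlim
  have hb : Tendsto (fun n => b (φ n)) atTop (𝓝 b') :=
    ((continuous_snd.comp continuous_fst).tendsto _).comp hlim
  have hsw : Tendsto (fun n => s (φ n)) atTop (𝓝 w) := (continuous_snd.tendsto _).comp hlim
  have hab' : e ≤ dist a' b' := ge_of_tendsto' (ha.dist hb) fun n => (hab _).le
  refine ⟨w, hw.2, mem_sphere_zero_iff_norm.1 hw.1, a', b', dist_pos.1 (he.trans_le hab'), ?_⟩
  intro h hh
  refine le_of_tendsto ((ha.const_smul h).dist (hb.const_smul h)) ?_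
  have hr : Tendsto (fun n => ‖u (φ n)‖) atTop atTop := by
    refine tendsto_atTop_mono (fun n => ?_)
      (tendsto_natCast_atTop_atTop.comp hφ.tendsto_atTop : Tendsto (fun n => (φ n : ℝ)) _ _)
    exact (lt_trans (lt_add_one _) (hg (φ n))).le
  have hin : Tendsto (fun n => inner ℝ (p h) (s (φ n))) atTop (𝓝 (inner ℝ (p h) w)) :=
    tendsto_const_nhds.inner hsw
  -- After squaring and cancelling `‖u‖ ^ 2`, the threshold `-2` bounds the left side by `‖u‖ -
  -- 4‖u‖`, which is below `-2‖u‖ + 1`. The bound `1 < ‖u‖` makes `‖u‖ - 1` nonnegative, so that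
  -- squares may be compared.
  filter_upwards [hr.eventually_ge_atTop (‖P (p h)‖ ^ 2), hr.eventually_gt_atTop 1,
    hin.eventually_lt_const hh] with n h1 h2 h3
  refine hclose _ h ?_
  have hinner : inner ℝ (P (p h)) (u (φ n)) = ‖u (φ n)‖ * inner ℝ (p h) (s (φ n)) := by
    have hmem : u (φ n) ∈ Vᗮ := Submodule.starProjection_apply_mem _ _
    rw [hP, Submodule.inner_starProjection_left_eq_right,
      Submodule.starProjection_eq_self_iff.2 hmem, hs, inner_smul_right, ← mul_assoc,
      mul_inv_cancel₀ (hupos _).ne', one_mul]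
  refine lt_of_pow_lt_pow_left₀ 2 (by simp only [hu] at h2; linarith) ?_
  change ‖P (p h) + u (φ n)‖ ^ 2 < (‖u (φ n)‖ - 1) ^ 2
  rw [norm_add_sq_real, hinner]
  nlinarith [hupos (φ n)]

/-- Boyle--Lind: nonexpansiveness along a proper subspace `V` is inherited by some hyperplane that
contains `V`. -/
theorem exists_nonexpansive_hyperplane (p : Γ → E)
    (hp : ∀ g h, p (g * h) = p g + p h)
    (hunb : ∀ w : E, w ≠ 0 → ∀ M : ℝ, ∃ h : Γ, inner ℝ (p h) w ≤ M)
    (V : Submodule ℝ E) (hV : V ≠ ⊤)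
    (hne : ∀ ε > 0, ∀ t > 0, ∃ x y : X, x ≠ y ∧
      ∀ h : Γ, ‖Vᗮ.starProjection (p h)‖ ≤ t → dist (h • x) (h • y) ≤ ε) :
    ∃ w ∈ Vᗮ, ‖w‖ = 1 ∧ ∀ ε > 0, ∀ t : ℝ, ∃ x y : X, x ≠ y ∧
      ∀ h : Γ, |inner ℝ (p h) w| ≤ t → dist (h • x) (h • y) ≤ ε := by
  by_cases hexp : ∃ e > 0, ∀ x y : X, (∀ h : Γ, dist (h • x) (h • y) ≤ e) → x = y
  · obtain ⟨e, he, hexp⟩ := hexp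
    obtain ⟨w, hwV, hw, a, b, hab, hclose⟩ :=
      exists_close_on_halfSpace p hp V he hexp (hne e he)
    refine ⟨w, hwV, hw, fun ε hε t => ?_⟩
    obtain ⟨T, hT⟩ := exists_radius_of_expansive p hexp hε
    -- For `‖p f‖ ≤ T` and `h` in the slab, `f * h * g` then pairs with `w` to at most `-3`, inside
    -- the half space.
    obtain ⟨g, hg⟩ := hunb w (norm_ne_zero_iff.1 (by rw [hw]; exact one_ne_zero)) (-(T + t + 3))
    refine ⟨g • a, g • b, (MulAction.injective g).ne hab, fun h hh => hT _ _ fun f hf => ?_⟩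
    rw [smul_smul, smul_smul, smul_smul, smul_smul]
    refine hclose _ ?_
    rw [hp, hp, inner_add_left, inner_add_left]
    have h1 : inner ℝ (p f) w ≤ ‖p f‖ * ‖w‖ := real_inner_le_norm _ _
    rw [hw, mul_one] at h1
    have h2 := le_abs_self (inner ℝ (p h) w)
    linarith
  · push Not at hexp
    obtain ⟨w, hw, hw0⟩ := Submodule.exists_mem_ne_zero_of_ne_bot
      (fun h => hV (Submodule.orthogonal_eq_bot_iff.1 h) : Vᗮ ≠ ⊥)
    refine ⟨‖w‖⁻¹ • w, Vᗮ.smul_mem _ hw, ?_, fun ε hε t => ?_⟩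
    · rw [norm_smul, norm_inv, norm_norm, inv_mul_cancel₀ (norm_ne_zero_iff.2 hw0)]
    · obtain ⟨x, y, h, hxy⟩ := hexp ε hε
      exact ⟨x, y, hxy, fun g _ => h g⟩

end Dynamics

namespace Heisenberg

/-! ### The symplectic form and commutators. -/

section Algebra

variable {D : ℕ}

theorem dilation_one (r : ℝ) : dilation r (1 : Heisenberg D) = 1 := by
  ext1 <;> simp [dilation]

/-- The complex structure `J (p, q) = (-q, p)`. -/
noncomputable def complexStructure (v : EuclideanSpace ℝ (Fin D ⊕ Fin D)) :
    EuclideanSpace ℝ (Fin D ⊕ Fin D) :=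
  WithLp.toLp 2 (Sum.elim (fun i => -v (Sum.inr i)) (fun i => v (Sum.inl i)))

theorem omega_complexStructure (v : EuclideanSpace ℝ (Fin D ⊕ Fin D)) :
    omega v (complexStructure v) = ‖v‖ ^ 2 := by
  simp only [omega, complexStructure, EuclideanSpace.norm_sq_eq, Fintype.sum_sum_type,
    ← Finset.sum_add_distrib, Sum.elim_inl, Sum.elim_inr, Real.norm_eq_abs, sq_abs]
  exact Finset.sum_congr rfl fun i _ => by ring

theorem norm_complexStructure (v : EuclideanSpace ℝ (Fin D ⊕ Fin D)) :
    ‖complexStructure v‖ = ‖v‖ := by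
  rw [← sq_eq_sq₀ (norm_nonneg _) (norm_nonneg _)]
  simp only [complexStructure, EuclideanSpace.norm_sq_eq, Fintype.sum_sum_type,
    Sum.elim_inl, Sum.elim_inr, norm_neg]
  rw [add_comm]

theorem omega_antisymm (v w : EuclideanSpace ℝ (Fin D ⊕ Fin D)) : omega w v = -omega v w := by
  simp only [omega, ← Finset.sum_neg_distrib]
  exact Finset.sum_congr rfl fun i _ => by ring

theorem omega_smul_right (r : ℝ) (v w : EuclideanSpace ℝ (Fin D ⊕ Fin D)) :
    omega v (r • w) = r * omega v w := by
  simp only [omega, Finset.mul_sum, PiLp.smul_apply, smul_eq_mul]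
  exact Finset.sum_congr rfl fun i _ => by ring

/-- Commutators are central and quadratic in the horizontal parts, matching the scaling of the
vertical coordinate; this is how the metric controls `‖g.v‖`. -/
theorem mul_mul_inv_mul_inv_eq (g h : Heisenberg D) :
    g * h * (g⁻¹ * h⁻¹) = ⟨0, omega g.v h.v⟩ := by
  ext1
  · simp only [mul_v, inv_v]; abel
  · simp only [mul_v, mul_u, inv_v, inv_u, omega_add_left, omega_add_right, omega_neg_left]
    have hr : ∀ a b : EuclideanSpace ℝ (Fin D ⊕ Fin D), omega a (-b) = -omega a b := fun a b => by
      rw [omega_antisymm (-b) a, omega_neg_left, neg_neg, omega_antisymm a b]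
    simp only [hr, omega_self, omega_antisymm g.v h.v]
    ring

end Algebra

/-! ### Homogeneous norm versus Euclidean norm. -/

section Norm

variable {D : ℕ} [MetricSpace (Heisenberg D)]

theorem IsHomogeneousMetric.dist_mul_one_le (hd : IsHomogeneousMetric D) (g h : Heisenberg D) :
    dist (g * h) 1 ≤ dist g 1 + dist h 1 := by
  have := hd.dist_mul_right h g 1
  rw [one_mul] at this
  rw [← this]
  exact dist_triangle _ _ _

theorem IsHomogeneousMetric.dist_inv_one (hd : IsHomogeneousMetric D) (g : Heisenberg D) :
    dist g⁻¹ 1 = dist g 1 := by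
  have := hd.dist_mul_right g g⁻¹ 1
  rw [inv_mul_cancel, one_mul] at this
  rw [← this, dist_comm]

theorem IsHomogeneousMetric.dist_mul_inv_one (hd : IsHomogeneousMetric D) (g h : Heisenberg D) :
    dist (g * h⁻¹) 1 = dist g h := by
  have := hd.dist_mul_right h⁻¹ g h
  rwa [mul_inv_cancel] at this

theorem IsHomogeneousMetric.dist_dilation_one (hd : IsHomogeneousMetric D) {r : ℝ} (hr : 0 < r)
    (g : Heisenberg D) : dist (dilation r g) 1 = r * dist g 1 := by
  have := hd.dist_dilation r hr g 1
  rwa [dilation_one] at this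

theorem IsHomogeneousMetric.dist_smul_one (hd : IsHomogeneousMetric D) (r : ℝ)
    (v : EuclideanSpace ℝ (Fin D ⊕ Fin D)) :
    dist (⟨r • v, 0⟩ : Heisenberg D) 1 = |r| * dist (⟨v, 0⟩ : Heisenberg D) 1 := by
  rcases lt_trichotomy r 0 with hr | rfl | hr
  · rw [abs_of_neg hr, ← hd.dist_dilation_one (neg_pos.2 hr), ← hd.dist_inv_one]
    congr 1
    ext1 <;> simp [dilation]
  · have : (⟨(0 : ℝ) • v, 0⟩ : Heisenberg D) = 1 := by ext1 <;> simp
    rw [this]; simp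
  · rw [abs_of_pos hr, ← hd.dist_dilation_one hr]
    congr 1
    ext1 <;> simp [dilation]

/-- Every horizontal vector lifts to an element of comparable homogeneous norm. -/
theorem IsHomogeneousMetric.exists_lift_dist_le (hd : IsHomogeneousMetric D) :
    ∃ C > 0, ∀ v : EuclideanSpace ℝ (Fin D ⊕ Fin D), ∃ u : ℝ,
      dist (⟨v, u⟩ : Heisenberg D) 1 ≤ C * ‖v‖ := by
  let B : Fin D ⊕ Fin D → ℝ := fun i => dist (⟨EuclideanSpace.single i 1, 0⟩ : Heisenberg D) 1
  have key : ∀ (v : EuclideanSpace ℝ (Fin D ⊕ Fin D)) (s : Finset (Fin D ⊕ Fin D)), ∃ u : ℝ,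
      dist (⟨∑ i ∈ s, v i • EuclideanSpace.single i 1, u⟩ : Heisenberg D) 1
        ≤ ∑ i ∈ s, |v i| * B i := by
    intro v s
    induction s using Finset.induction_on with
    | empty =>
      refine ⟨0, ?_⟩
      simp only [Finset.sum_empty]
      exact (dist_self (1 : Heisenberg D)).le
    | insert i s hi ih =>
      obtain ⟨u, hu⟩ := ih
      set g : Heisenberg D := ⟨v i • EuclideanSpace.single i 1, 0⟩
      set h : Heisenberg D := ⟨∑ i ∈ s, v i • EuclideanSpace.single i 1, u⟩
      -- The vertical coordinate is whatever the product of axis elements produces.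
      refine ⟨(g * h).u, ?_⟩
      rw [Finset.sum_insert hi, Finset.sum_insert hi]
      calc dist (g * h) 1 ≤ dist g 1 + dist h 1 := hd.dist_mul_one_le _ _
        _ ≤ _ := add_le_add (hd.dist_smul_one _ _).le hu
  have hB : 0 ≤ ∑ i, B i := Finset.sum_nonneg fun i _ => dist_nonneg
  -- The `+ 1` keeps the constant positive even when there are no coordinates.
  refine ⟨∑ i, B i + 1, by positivity, fun v => ?_⟩
  obtain ⟨u, hu⟩ := key v Finset.univ
  have hv : ∑ i, v i • EuclideanSpace.single i (1 : ℝ) = v := by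
    ext j
    simp only [PiLp.smul_apply, WithLp.ofLp_sum, Finset.sum_apply, PiLp.single_apply, smul_eq_mul,
      mul_ite, mul_one, mul_zero, Finset.sum_ite_eq, Finset.mem_univ, if_true]
  rw [hv] at hu
  refine ⟨u, hu.trans ?_⟩
  calc ∑ i, |v i| * B i ≤ ∑ i, ‖v‖ * B i :=
        Finset.sum_le_sum fun i _ =>
          mul_le_mul_of_nonneg_right (PiLp.norm_apply_le v i) dist_nonneg
    _ = (∑ i, B i) * ‖v‖ := by rw [← Finset.mul_sum, mul_comm]
    _ ≤ _ := by nlinarith [norm_nonneg v]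

/-- The homogeneous norm dominates the Euclidean norm of the horizontal part. -/
theorem IsHomogeneousMetric.exists_norm_le_dist (hd : IsHomogeneousMetric D) :
    ∃ c > 0, ∀ g : Heisenberg D, c * ‖g.v‖ ≤ dist g 1 := by
  obtain ⟨C, hC, hlift⟩ := hd.exists_lift_dist_le
  set z := dist (⟨0, 1⟩ : Heisenberg D) 1 with hz
  have hzpos : 0 < z := dist_pos.2 fun h => one_ne_zero (congrArg Heisenberg.u h)
  -- Half the maximum of `r * z - 2 * C * r ^ 2`, attained at `r = z / (4 * C)`.
  refine ⟨z ^ 2 / (16 * C), by positivity, fun g => ?_⟩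
  rcases eq_or_ne g.v 0 with hg0 | hg0
  · rw [hg0, norm_zero, mul_zero]; exact dist_nonneg
  have hgpos : 0 < ‖g.v‖ := norm_pos_iff.2 hg0
  obtain ⟨u, hu⟩ := hlift (complexStructure g.v)
  rw [norm_complexStructure] at hu
  have hr : 0 < z / (4 * C) := by positivity
  set r := z / (4 * C) with hrdef
  -- The commutator of `g` and `h` is then `(0, r² ‖g.v‖²)`, the dilation of `(0, 1)` by `r ‖g.v‖`:
  -- linear in `r`, while the norm of `h` is quadratic.
  set h : Heisenberg D := dilation (r ^ 2) ⟨complexStructure g.v, u⟩ with hh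
  have hhd : dist h 1 ≤ r ^ 2 * (C * ‖g.v‖) := by
    rw [hh, hd.dist_dilation_one (by positivity)]
    gcongr
  have hcomm : dist (g * h * (g⁻¹ * h⁻¹)) 1 = r * ‖g.v‖ * z := by
    rw [mul_mul_inv_mul_inv_eq, hz, ← hd.dist_dilation_one (mul_pos hr hgpos)]
    congr 1
    ext1
    · simp [dilation]
    · simp only [dilation, hh, omega_smul_right, omega_complexStructure]; ring
  have h1 := hd.dist_mul_one_le (g * h) (g⁻¹ * h⁻¹)
  have h2 := hd.dist_mul_one_le g h
  have h3 := hd.dist_mul_one_le g⁻¹ h⁻¹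
  rw [hd.dist_inv_one, hd.dist_inv_one] at h3
  have h4 : r * ‖g.v‖ * z ≤ 2 * dist g 1 + 2 * (r ^ 2 * (C * ‖g.v‖)) := by
    rw [← hcomm]; linarith
  have h5 : r * ‖g.v‖ * z - 2 * (r ^ 2 * (C * ‖g.v‖)) = 2 * (z ^ 2 / (16 * C) * ‖g.v‖) := by
    rw [hrdef]; field_simp; ring
  linarith

end Norm

/-! ### Vertical groups and unboundedness of the discrete group. -/

section Groups

variable {D : ℕ}

/-- The vertical group `V × ℝ`. -/
def verticalGroup (V : Submodule ℝ (EuclideanSpace ℝ (Fin D ⊕ Fin D))) :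
    Subgroup (Heisenberg D) where
  carrier := {g | g.v ∈ V}
  mul_mem' := fun {_ _} hg hh => V.add_mem hg hh
  one_mem' := V.zero_mem
  inv_mem' := fun {_} hg => V.neg_mem hg

theorem verticalGroup_normal (V : Submodule ℝ (EuclideanSpace ℝ (Fin D ⊕ Fin D))) :
    (verticalGroup V).Normal :=
  ⟨fun n hn g => by
    change g.v + n.v + -g.v ∈ V
    rw [add_neg_cancel_comm]
    exact hn⟩

/-- Some generator pairs nontrivially with `w`; it or its inverse pairs negatively, and powers do
the rest. -/
theorem exists_discrete_inner_le (w : EuclideanSpace ℝ (Fin D ⊕ Fin D)) (hw : w ≠ 0) (M : ℝ) :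
    ∃ h : discrete D, inner ℝ (h : Heisenberg D).v w ≤ M := by
  obtain ⟨i, hi⟩ : ∃ i, w i ≠ 0 := by
    by_contra! h
    exact hw (PiLp.ext h)
  obtain ⟨g, hg⟩ : ∃ g : discrete D, (g : Heisenberg D).v = EuclideanSpace.single i 1 := by
    rcases i with i | i
    · exact ⟨⟨x i, Subgroup.subset_closure (Or.inl ⟨i, rfl⟩)⟩, rfl⟩
    · exact ⟨⟨y i, Subgroup.subset_closure (Or.inr ⟨i, rfl⟩)⟩, rfl⟩
  have hin : inner ℝ (g : Heisenberg D).v w = w i := by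
    rw [hg, EuclideanSpace.inner_single_left]; simp
  obtain ⟨f, hf⟩ : ∃ f : discrete D, inner ℝ (f : Heisenberg D).v w < 0 := by
    rcases lt_or_gt_of_ne hi with h | h
    · exact ⟨g, hin.trans_lt h⟩
    · refine ⟨g⁻¹, ?_⟩
      rw [Subgroup.coe_inv, inv_v, inner_neg_left, hin]
      linarith
  have hpow : ∀ n : ℕ, inner ℝ ((f ^ n : discrete D) : Heisenberg D).v w
      = n * inner ℝ (f : Heisenberg D).v w := by
    intro n
    induction n with
    | zero => simp
    | succ n ih =>
      rw [pow_succ, Subgroup.coe_mul, mul_v, inner_add_left, ih]; push_cast; ring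
  obtain ⟨n, hn⟩ := exists_nat_ge (M / inner ℝ (f : Heisenberg D).v w)
  refine ⟨f ^ n, ?_⟩
  rw [hpow]
  exact (div_le_iff_of_neg hf).1 hn

end Groups

/-! ### Expansiveness in terms of Euclidean strips. -/

section Expansive

variable {D : ℕ} {X : Type*} [MetricSpace X] [MulAction (discrete D) X]

theorem dist_le_distAlong [CompactSpace X] {A : Set (Heisenberg D)} {g : discrete D} (hg : (g : Heisenberg D) ∈ A)
    (x y : X) : dist (g • x) (g • y) ≤ distAlong X A x y := by
  -- Compactness is needed here: an unbounded `sSup` would be 0.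
  refine le_csSup ⟨Metric.diam (Set.univ : Set X), ?_⟩ ⟨g, hg, rfl⟩
  rintro _ ⟨h, -, rfl⟩
  exact Metric.dist_le_diam_of_mem isCompact_univ.isBounded (Set.mem_univ _) (Set.mem_univ _)

variable [MetricSpace (Heisenberg D)]

/-- Lift the component of `h.v` orthogonal to `V` to a short `f`. Then `f⁻¹ * h` lies in `A`, and
right invariance makes its distance to `h` the norm of `f`. -/
theorem IsHomogeneousMetric.exists_close_of_not_isExpansive [CompactSpace X]
    (hd : IsHomogeneousMetric D)
    (V : Submodule ℝ (EuclideanSpace ℝ (Fin D ⊕ Fin D))) {A : Set (Heisenberg D)}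
    (hA : A = {g | g.v ∈ V}) (hne : ¬ IsExpansive X A) {ε t : ℝ} (hε : 0 < ε) (ht : 0 < t) :
    ∃ x y : X, x ≠ y ∧ ∀ h : discrete D,
      ‖Vᗮ.starProjection (h : Heisenberg D).v‖ ≤ t → dist (h • x) (h • y) ≤ ε := by
  obtain ⟨C, hC, hlift⟩ := hd.exists_lift_dist_le
  unfold IsExpansive at hne
  push Not at hne
  obtain ⟨x, y, hle, hxy⟩ := hne ε hε (C * t) (by positivity)
  refine ⟨x, y, hxy, fun h hh => (dist_le_distAlong ?_ x y).trans hle⟩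
  obtain ⟨u, hu⟩ := hlift (Vᗮ.starProjection (h : Heisenberg D).v)
  set f : Heisenberg D := ⟨Vᗮ.starProjection (h : Heisenberg D).v, u⟩ with hf
  refine Metric.mem_cthickening_of_dist_le _ (f⁻¹ * h) _ _ ?_ ?_
  · rw [hA]
    change -Vᗮ.starProjection (h : Heisenberg D).v + (h : Heisenberg D).v ∈ V
    have : -Vᗮ.starProjection (h : Heisenberg D).v + (h : Heisenberg D).v
        = V.starProjection (h : Heisenberg D).v := by
      rw [neg_add_eq_sub, sub_eq_iff_eq_add, Submodule.starProjection_add_starProjection_orthogonal]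
    rw [this]
    exact Submodule.starProjection_apply_mem _ _
  · rw [← hd.dist_mul_inv_one, mul_inv_rev, inv_inv, mul_inv_cancel_left]
    exact hu.trans (by gcongr)

/-- If `f` lies in the vertical group, `h * f⁻¹` pairs with `w` exactly as `h` does, so the lower
norm bound places the thickening inside a slab. -/
theorem IsHomogeneousMetric.not_isExpansive_verticalGroup (hd : IsHomogeneousMetric D)
    {w : EuclideanSpace ℝ (Fin D ⊕ Fin D)} (hw : ‖w‖ = 1)
    (hclose : ∀ ε > 0, ∀ t : ℝ, ∃ x y : X, x ≠ y ∧ ∀ h : discrete D,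
      |inner ℝ (h : Heisenberg D).v w| ≤ t → dist (h • x) (h • y) ≤ ε) :
    ¬ IsExpansive X (verticalGroup (ℝ ∙ w)ᗮ : Set (Heisenberg D)) := by
  rintro ⟨ε, hε, t, ht, hexp⟩
  obtain ⟨c, hc, hle⟩ := hd.exists_norm_le_dist
  -- Passing to the open thickening of radius `t + 1` yields an actual nearby point of the group.
  obtain ⟨x, y, hxy, hclose⟩ := hclose ε hε ((t + 1) / c)
  refine hxy (hexp x y (Real.sSup_le ?_ hε.le))
  rintro _ ⟨h, hh, rfl⟩
  refine hclose h ?_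
  obtain ⟨f, hf, hhf⟩ := Metric.mem_thickening_iff.1
    (Metric.cthickening_subset_thickening' (by linarith) (lt_add_one t) _ hh)
  have hfw : inner ℝ f.v w = 0 := by
    rw [real_inner_comm]
    exact Submodule.mem_orthogonal_singleton_iff_inner_right.1 hf
  have h1 := hle (h * f⁻¹)
  rw [hd.dist_mul_inv_one, mul_v, inv_v, ← sub_eq_add_neg] at h1
  rw [le_div_iff₀' hc]
  have h2 : |inner ℝ (h : Heisenberg D).v w| ≤ ‖(h : Heisenberg D).v - f.v‖ := by
    have := abs_real_inner_le_norm ((h : Heisenberg D).v - f.v) w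
    rwa [inner_sub_left, hfw, sub_zero, hw, mul_one] at this
  exact (mul_le_mul_of_nonneg_left h2 hc.le).trans (h1.trans hhf.le)

end Expansive

end Heisenberg

theorem theorem5p11 (D : ℕ) (hD : 0 < D)
    [MetricSpace (Heisenberg D)] (hd : Heisenberg.IsHomogeneousMetric D)
    (X : Type*) [MetricSpace X] [CompactSpace X]
    [MulAction (Heisenberg.discrete D) X] [ContinuousConstSMul (Heisenberg.discrete D) X]
    (G : Subgroup (Heisenberg D)) (k : ℕ) (hk : k ≤ 2 * D - 1)
    (hG : Heisenberg.IsVerticalGroup G k)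
    (hGne : ¬ Heisenberg.IsExpansive X (G : Set (Heisenberg D))) :
    ∃ F : Subgroup (Heisenberg D), Heisenberg.IsVerticalGroup F (2 * D) ∧
      ¬ Heisenberg.IsExpansive X (F : Set (Heisenberg D)) ∧ G ≤ F := by
  obtain ⟨-, V, hGV, hVk⟩ := hG
  have hrank : Module.finrank ℝ (EuclideanSpace ℝ (Fin D ⊕ Fin D)) = 2 * D := by
    simp [two_mul]
  have hV : V ≠ ⊤ := by
    rintro rfl
    rw [finrank_top, hrank] at hVk
    omega
  obtain ⟨w, hwV, hw, hclose⟩ := exists_nonexpansive_hyperplane (X := X)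
    (fun h : Heisenberg.discrete D => (h : Heisenberg D).v) (fun _ _ => rfl)
    Heisenberg.exists_discrete_inner_le V hV
    (fun ε hε t ht => hd.exists_close_of_not_isExpansive V hGV hGne hε ht)
  refine ⟨Heisenberg.verticalGroup (ℝ ∙ w)ᗮ,
    ⟨Heisenberg.verticalGroup_normal _, (ℝ ∙ w)ᗮ, rfl, ?_⟩,
    hd.not_isExpansive_verticalGroup hw hclose, fun g hg => ?_⟩
  · have h1 := Submodule.finrank_add_finrank_orthogonal (ℝ ∙ w)
    rw [finrank_span_singleton (norm_ne_zero_iff.1 (by rw [hw]; exact one_ne_zero)), hrank] at h1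
    omega
  · have hgV : g.v ∈ V := by
      have : g ∈ (G : Set (Heisenberg D)) := hg
      rwa [hGV] at this
    exact Submodule.mem_orthogonal_singleton_iff_inner_left.2
      (Submodule.inner_right_of_mem_orthogonal hgV hwV)
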